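/- Let $\mathcal{G}$ be a second countable, Hausdorff, locally compact, totally disconnected topological group and let $T$ be an automorphism of the topological group $\mathcal{G}$. Say that $\mathcal{U}\subseteq\mathcal{G}$ separates points if for all $g\neq h$ in $\mathcal{G}$ there is $n\in\mathbb{Z}$ with $T^n(g)\notin T^n(h)\,\mathcal{U}$, and suppose that $T$ is expansive, i.e. some neighborhood of the identity separates points. Let $\mathcal{H}$ be any compact open subgroup of $\mathcal{G}$ that separates points. Let $\mathcal{G}_c$ be the closure of the set of points $g\in\mathcal{G}$ whose orbit $\{T^n(g):n\in\mathbb{Z}\}$ has compact closure in $\mathcal{G}$, and let $\mathcal{G}_t$ be the closure of the set of points $g\in\mathcal{G}$ for which there is $N\in\mathbb{N}$ with $T^n(g)\in\mathcal{H}$ for all $n\in\mathbb{Z}$ with $|n|\geq N$. Both are closed subgroups of $\mathcal{G}$, and $T(\mathcal{G}_t)=\mathcal{G}_t$; let $T_t$ be the restriction of $T$ to $\mathcal{G}_t$. Then: 1. $\mathcal{G}_t$ is compact. 2. The system $(\mathcal{G}_t,T_t)$ is topologically conjugate to a full shift on a finite number of symbols: there are an integer $k\geq 1$ and a homeomorphism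 $\varphi:\mathcal{G}_t\to\{1,\dots,k\}^{\mathbb{Z}}$ (product of discrete topologies) with $\varphi\circ T_t=\sigma\circ\varphi$, where $\sigma(x)_i=x_{i+1}$. 3. $\mathcal{G}_t\subseteq\mathcal{G}_c$, and $\mathcal{G}_t$ is open in $\mathcal{G}_c$. 4. The coset space $\mathcal{G}_c/\mathcal{G}_t$, with the quotient topology, is countable and discrete. -/

import Mathlib

open scoped Pointwise

namespace ExpansiveAut

/-- The `n`-th iterate (`n : ℤ`) of an automorphism `T` of a topological group. -/
def iter {G : Type*} [Group G] [TopologicalSpace G] (T : G ≃ₜ* G) (n : ℤ) : MulAut G :=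
  (show MulAut G from T.toMulEquiv) ^ n

theorem iter_apply_apply {G : Type*} [Group G] [TopologicalSpace G] (T : G ≃ₜ* G) (n : ℤ)
    (g : G) : iter T n (T g) = iter T (n + 1) g := by
  unfold iter
  rw [zpow_add_one]
  rfl

/-- `U` separates points under `T`: whenever `g ≠ h`, some iterate satisfies
`Tⁿ g ∉ Tⁿ(h) U`. -/
def SeparatesPoints {G : Type*} [Group G] [TopologicalSpace G] (T : G ≃ₜ* G) (U : Set G) :
    Prop :=
  ∀ g h : G, g ≠ h → ∃ n : ℤ, iter T n g ∉ (iter T n h) • U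

/-- `T` is expansive: some neighborhood of the identity separates points. -/
def IsExpansive {G : Type*} [Group G] [TopologicalSpace G] (T : G ≃ₜ* G) : Prop :=
  ∃ U ∈ nhds (1 : G), SeparatesPoints T U

/-- The two-sided `T`-orbit of `g`. -/
def orbit {G : Type*} [Group G] [TopologicalSpace G] (T : G ≃ₜ* G) (g : G) : Set G :=
  Set.range fun n : ℤ => iter T n g

/-- The subgroup of points whose `T`-orbit closure is compact. -/
def compactOrbitPoints {G : Type*} [Group G] [TopologicalSpace G] [IsTopologicalGroup G]
    (T : G ≃ₜ* G) : Subgroup G where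
  carrier := {g | IsCompact (closure (orbit T g))}
  one_mem' := by
    have h : orbit T (1 : G) = {1} := by
      ext x
      simp [orbit]
    change IsCompact (closure (orbit T (1 : G)))
    rw [h]
    exact isCompact_singleton.closure
  mul_mem' := by
    intro a b ha hb
    refine (IsCompact.mul ha hb).closure_of_subset ?_
    rintro _ ⟨n, rfl⟩
    dsimp only
    rw [map_mul]
    exact Set.mul_mem_mul (subset_closure ⟨n, rfl⟩) (subset_closure ⟨n, rfl⟩)
  inv_mem' := by
    intro a ha
    refine (IsCompact.inv ha).closure_of_subset ?_
    rintro _ ⟨n, rfl⟩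
    dsimp only
    rw [map_inv, Set.mem_inv, inv_inv]
    exact subset_closure ⟨n, rfl⟩

/-- The subgroup of points `g` for which there is `N ∈ ℕ` with `Tⁿ g ∈ H` whenever `|n| ≥ N`. -/
def eventuallyIn {G : Type*} [Group G] [TopologicalSpace G] (T : G ≃ₜ* G) (H : Subgroup G) :
    Subgroup G where
  carrier := {g | ∃ N : ℕ, ∀ n : ℤ, (N : ℤ) ≤ |n| → iter T n g ∈ H}
  one_mem' := ⟨0, fun n _ => by rw [map_one]; exact H.one_mem⟩
  mul_mem' := by
    rintro a b ⟨N, hN⟩ ⟨M, hM⟩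
    refine ⟨N + M, fun n hn => ?_⟩
    rw [map_mul]
    push_cast at hn
    exact H.mul_mem (hN n (by omega)) (hM n (by omega))
  inv_mem' := by
    rintro a ⟨N, hN⟩
    refine ⟨N, fun n hn => ?_⟩
    rw [map_inv]
    exact H.inv_mem (hN n hn)

/-- `G_c`: the closure of the set of points whose `T`-orbit closure is compact. -/
def Gc {G : Type*} [Group G] [TopologicalSpace G] [IsTopologicalGroup G] (T : G ≃ₜ* G) :
    Subgroup G :=
  (compactOrbitPoints T).topologicalClosure

/-- `G_t`: the closure of the set of points that lie in `H` eventually in both time directions. -/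
def Gt {G : Type*} [Group G] [TopologicalSpace G] [IsTopologicalGroup G] (T : G ≃ₜ* G)
    (H : Subgroup G) : Subgroup G :=
  (eventuallyIn T H).topologicalClosure

theorem apply_mem_eventuallyIn_iff {G : Type*} [Group G] [TopologicalSpace G] (T : G ≃ₜ* G)
    (H : Subgroup G) (g : G) : T g ∈ eventuallyIn T H ↔ g ∈ eventuallyIn T H := by
  constructor
  · rintro ⟨N, hN⟩
    refine ⟨N + 1, fun n hn => ?_⟩
    have h := hN (n - 1) (by push_cast at hn; grind)
    rwa [iter_apply_apply, sub_add_cancel] at h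
  · rintro ⟨N, hN⟩
    refine ⟨N + 1, fun n hn => ?_⟩
    rw [iter_apply_apply]
    exact hN (n + 1) (by push_cast at hn; grind)

theorem apply_mem_Gt_iff {G : Type*} [Group G] [TopologicalSpace G] [IsTopologicalGroup G]
    (T : G ≃ₜ* G) (H : Subgroup G) (g : G) : T g ∈ Gt T H ↔ g ∈ Gt T H := by
  have hpre : T ⁻¹' (eventuallyIn T H : Set G) = (eventuallyIn T H : Set G) :=
    Set.ext fun x => apply_mem_eventuallyIn_iff T H x
  have h := T.toHomeomorph.preimage_closure (eventuallyIn T H : Set G)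
  change T ⁻¹' closure (eventuallyIn T H : Set G) = closure (T ⁻¹' (eventuallyIn T H : Set G)) at h
  rw [hpre] at h
  exact Set.ext_iff.1 h g

/-- `T_t`: the restriction of `T` to `G_t`, an automorphism of the topological group `G_t`. -/
def Tt {G : Type*} [Group G] [TopologicalSpace G] [IsTopologicalGroup G] (T : G ≃ₜ* G)
    (H : Subgroup G) : Gt T H ≃ₜ* Gt T H where
  toFun g := ⟨T g, (apply_mem_Gt_iff T H g).2 g.2⟩
  invFun g := ⟨T.symm g, (apply_mem_Gt_iff T H _).1 (by simp)⟩
  left_inv g := by simp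
  right_inv g := by simp
  map_mul' a b := by simp
  continuous_toFun :=
    (T.continuous_toFun.comp continuous_subtype_val).subtype_mk _
  continuous_invFun :=
    (T.continuous_invFun.comp continuous_subtype_val).subtype_mk _

/-- The systems `(X, S)` and `(Y, R)` are topologically conjugate. -/
def TopConjugate {X Y : Type*} [TopologicalSpace X] [TopologicalSpace Y] (S : X → X)
    (R : Y → Y) : Prop :=
  ∃ φ : X ≃ₜ Y, Function.Semiconj φ S R

end ExpansiveAut

/-! Write E for `eventuallyIn T H`. Compactness of its closure: the times before `-N` at which a
point of E may lie outside `H` are repaired one by one, from the earliest on, by dividing by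
translates of finitely many fixed points of E. These translates themselves lie in `H`, so E is
contained in `H` times a compact set (`exists_eventuallyIn_subset`).

Openness in `Gc`: `H` contains an open `V` each of whose elements splits into a factor with past in
`V` and one with future in `V` (`exists_isTidyAbove`). If the orbit of the element is relatively
compact, so are those of the factors. Pigeonhole on cosets of `V` then gives near-returns of a
factor, which the splitting turns into homoclinic points converging to it (`mem_Gt_of_past_mem`).
Hence `V ⊓ Gc T ≤ Gt T H`, and the coset space is discrete; second countability makes it countable.

Full shift: recording cosets of an open normal subgroup embeds the compact group `Gt` as a closed
shift-invariant subgroup `X` of `ℤ → A`, with `A` a finite group, in which finitely supported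
sequences are dense (`topConjugate_fullShift`). For each possible first value choose one generator
in `X`, with choices compatible with the lengths of supports. Every element of `X` is then an
ordered product of translated generators, with free and unique coefficients (`surjOn_encode`,
`injOn_encode`); the coefficients are the symbols of the full shift. -/

namespace ExpansiveAut

/-! ### Iterates, points confined to `V` during a time set, and homoclinic points -/

section Basic

variable {G : Type*} [Group G] [TopologicalSpace G]

theorem iter_add_apply (T : G ≃ₜ* G) (m n : ℤ) (g : G) :
    iter T (m + n) g = iter T m (iter T n g) := by
  unfold iter
  rw [zpow_add]
  rfl

@[simp] theorem iter_zero_apply (T : G ≃ₜ* G) (g : G) : iter T 0 g = g := by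
  simp [iter]

theorem iter_one_apply (T : G ≃ₜ* G) (g : G) : iter T 1 g = T g := by
  have h := iter_apply_apply T 0 g
  rw [iter_zero_apply, zero_add] at h
  exact h.symm

@[simp] theorem iter_neg_iter (T : G ≃ₜ* G) (n : ℤ) (g : G) : iter T (-n) (iter T n g) = g := by
  rw [← iter_add_apply, neg_add_cancel, iter_zero_apply]

@[simp] theorem iter_iter_neg (T : G ≃ₜ* G) (n : ℤ) (g : G) : iter T n (iter T (-n) g) = g := by
  rw [← iter_add_apply, add_neg_cancel, iter_zero_apply]

theorem iter_symm (T : G ≃ₜ* G) (n : ℤ) (g : G) : iter T.symm n g = iter T (-n) g := by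
  have h : (show MulAut G from T.symm.toMulEquiv) = (show MulAut G from T.toMulEquiv)⁻¹ := rfl
  unfold iter
  rw [h, inv_zpow, zpow_neg]

theorem continuous_iter (T : G ≃ₜ* G) (n : ℤ) : Continuous (iter T n) := by
  induction n with
  | zero => simpa [funext_iff] using continuous_id.congr fun g => (iter_zero_apply T g).symm
  | succ n ih =>
    exact (ih.comp T.continuous_toFun).congr fun g => iter_apply_apply T n g
  | pred n ih =>
    refine (ih.comp T.continuous_invFun).congr fun g => ?_
    have h := iter_apply_apply T (-(n : ℤ) - 1) (T.symm g)
    rw [sub_add_cancel, ContinuousMulEquiv.apply_symm_apply] at h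
    exact h.symm

/-- The subgroup of points that lie in `V` at all times `n ∈ I`. -/
def stay (T : G ≃ₜ* G) (V : Subgroup G) (I : Set ℤ) : Subgroup G where
  carrier := {g | ∀ n ∈ I, iter T n g ∈ V}
  one_mem' n _ := by simp
  mul_mem' ha hb n hn := by
    rw [map_mul]
    exact V.mul_mem (ha n hn) (hb n hn)
  inv_mem' ha n hn := by
    rw [map_inv]
    exact V.inv_mem (ha n hn)

theorem mem_stay {T : G ≃ₜ* G} {V : Subgroup G} {I : Set ℤ} {g : G} :
    g ∈ stay T V I ↔ ∀ n ∈ I, iter T n g ∈ V := Iff.rfl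

theorem iter_mem_stay {T : G ≃ₜ* G} {V : Subgroup G} {I : Set ℤ} {g : G} (m : ℤ) :
    iter T m g ∈ stay T V I ↔ ∀ n ∈ I, iter T (n + m) g ∈ V := by
  simp only [mem_stay, iter_add_apply]

theorem stay_anti (T : G ≃ₜ* G) (V : Subgroup G) {I J : Set ℤ} (h : I ⊆ J) :
    stay T V J ≤ stay T V I := fun _ hg n hn => hg n (h hn)

theorem isClosed_stay (T : G ≃ₜ* G) {V : Subgroup G} (hV : IsClosed (V : Set G)) (I : Set ℤ) :
    IsClosed (stay T V I : Set G) := by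
  have h : (stay T V I : Set G) = ⋂ n ∈ I, iter T n ⁻¹' V := by
    ext g
    simp [mem_stay]
  rw [h]
  exact isClosed_biInter fun n _ => hV.preimage (continuous_iter T n)

theorem isOpen_stay (T : G ≃ₜ* G) {V : Subgroup G} (hV : IsOpen (V : Set G)) {I : Set ℤ}
    (hI : I.Finite) : IsOpen (stay T V I : Set G) := by
  have h : (stay T V I : Set G) = ⋂ n ∈ I, iter T n ⁻¹' V := by
    ext g
    simp [mem_stay]
  rw [h]
  exact hI.isOpen_biInter fun n _ => hV.preimage (continuous_iter T n)

theorem isCompact_stay [T2Space G] (T : G ≃ₜ* G) {V : Subgroup G} (hV : IsCompact (V : Set G))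
    {I : Set ℤ} (hI : I.Nonempty) : IsCompact (stay T V I : Set G) := by
  obtain ⟨n, hn⟩ := hI
  refine (hV.image (continuous_iter T (-n))).of_isClosed_subset (isClosed_stay T hV.isClosed I) ?_
  exact fun g hg => ⟨iter T n g, hg n hn, iter_neg_iter T n g⟩

theorem stay_univ (T : G ≃ₜ* G) {H : Subgroup G} (hs : SeparatesPoints T (H : Set G)) :
    stay T H Set.univ = ⊥ := by
  refine (Subgroup.eq_bot_iff_forall _).2 fun g hg => ?_
  by_contra hne
  obtain ⟨n, hn⟩ := hs g 1 hne
  rw [map_one, one_smul] at hn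
  exact hn (hg n trivial)

/-- These compact sets decrease to `stay T H Set.univ`, which is trivial by separation. Thus staying
in `H` over a long finite window forces closeness to the identity. -/
theorem exists_stay_subset [T2Space G] (T : G ≃ₜ* G) {H : Subgroup G}
    (hc : IsCompact (H : Set G)) (hs : SeparatesPoints T (H : Set G)) {U : Set G}
    (hU : U ∈ nhds (1 : G)) : ∃ D : ℕ, (stay T H (Set.Icc (-D : ℤ) D) : Set G) ⊆ U := by
  refine exists_subset_nhds_of_isCompact
    (V := fun D : ℕ => (stay T H (Set.Icc (-D : ℤ) D) : Set G)) ?_ ?_ ?_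
  · refine directed_of_isDirected_le fun a b hab => stay_anti T H (Set.Icc_subset_Icc ?_ ?_)
    all_goals omega
  · exact fun D => isCompact_stay T hc ⟨0, by simp⟩
  · intro x hx
    have h : x ∈ stay T H Set.univ := fun n _ =>
      Set.mem_iInter.1 hx n.natAbs n ⟨by omega, by omega⟩
    rw [stay_univ T hs, Subgroup.mem_bot] at h
    rwa [h]

theorem mem_eventuallyIn {T : G ≃ₜ* G} {H : Subgroup G} {g : G} :
    g ∈ eventuallyIn T H ↔ ∃ N : ℕ, ∀ n : ℤ, (N : ℤ) ≤ |n| → iter T n g ∈ H := Iff.rfl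

theorem iter_mem_eventuallyIn {T : G ≃ₜ* G} {H : Subgroup G} {g : G} (hg : g ∈ eventuallyIn T H)
    (m : ℤ) : iter T m g ∈ eventuallyIn T H := by
  obtain ⟨N, hN⟩ := hg
  refine ⟨N + m.natAbs, fun n hn => ?_⟩
  rw [← iter_add_apply]
  exact hN _ (by push_cast at hn; grind)

theorem eventuallyIn_mono (T : G ≃ₜ* G) {V H : Subgroup G} (h : V ≤ H) :
    eventuallyIn T V ≤ eventuallyIn T H := fun _ ⟨N, hN⟩ => ⟨N, fun n hn => h (hN n hn)⟩

/-- Points of `eventuallyIn T H` are homoclinic to the identity. -/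
theorem exists_iter_mem_of_mem_nhds [T2Space G] {T : G ≃ₜ* G} {H : Subgroup G}
    (hc : IsCompact (H : Set G)) (hs : SeparatesPoints T (H : Set G)) {U : Set G}
    (hU : U ∈ nhds (1 : G)) {g : G} (hg : g ∈ eventuallyIn T H) :
    ∃ N : ℕ, ∀ n : ℤ, (N : ℤ) ≤ |n| → iter T n g ∈ U := by
  obtain ⟨D, hD⟩ := exists_stay_subset T hc hs hU
  obtain ⟨N, hN⟩ := hg
  refine ⟨N + D, fun n hn => hD ((iter_mem_stay n).2 fun k hk => hN _ ?_)⟩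
  obtain ⟨h1, h2⟩ := hk
  push_cast at hn
  grind

end Basic

/-! ### Compactness of `Gt` -/

section Compact

variable {G : Type*} [Group G] [TopologicalSpace G] [IsTopologicalGroup G]

theorem finite_image_mk_of_isCompact {V : Subgroup G} (hV : IsOpen (V : Set G)) {K : Set G}
    (hK : IsCompact K) : ((QuotientGroup.mk : G → G ⧸ V) '' K).Finite := by
  have := QuotientGroup.discreteTopology hV
  exact (hK.image QuotientGroup.continuous_mk).finite_of_discrete

/-- A subset of a compact set is covered by finitely many cosets of an open subgroup, with
representatives in the set. -/
theorem exists_finite_coset_cover {V : Subgroup G} (hV : IsOpen (V : Set G)) {K M : Set G}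
    (hK : IsCompact K) (hM : M ⊆ K) :
    ∃ S ⊆ M, S.Finite ∧ ∀ x ∈ M, ∃ s ∈ S, s⁻¹ * x ∈ V := by
  obtain ⟨S, hSM, hS⟩ := Set.exists_subset_bijOn M (QuotientGroup.mk : G → G ⧸ V)
  refine ⟨S, hSM, ?_, fun x hx => ?_⟩
  · refine Set.Finite.of_finite_image ?_ hS.injOn
    rw [hS.image_eq]
    exact (finite_image_mk_of_isCompact hV hK).subset (Set.image_mono hM)
  · obtain ⟨s, hs, hsx⟩ := hS.surjOn (Set.mem_image_of_mem _ hx)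
    exact ⟨s, hs, QuotientGroup.eq.1 hsx⟩

/-- `eventuallyIn T H` is contained in a compact set. -/
theorem exists_eventuallyIn_subset [T2Space G] (T : G ≃ₜ* G) {H : Subgroup G}
    (hc : IsCompact (H : Set G)) (ho : IsOpen (H : Set G)) :
    ∃ Q : Set G, IsCompact Q ∧ (eventuallyIn T H : Set G) ⊆ Q := by
  obtain ⟨S, hSM, hSf, hS⟩ := exists_finite_coset_cover ho
    (isCompact_stay T hc (I := Set.Iio 0) ⟨-1, by simp⟩)
    (M := (eventuallyIn T H ⊓ stay T H (Set.Iio 0) : Subgroup G)) (fun x hx => hx.2)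
  have hN : ∃ N : ℕ, ∀ s ∈ S, ∀ n : ℤ, (N : ℤ) ≤ n → iter T n s ∈ H := by
    have h : ∀ s ∈ S, ∃ N : ℕ, ∀ n : ℤ, (N : ℤ) ≤ |n| → iter T n s ∈ H := fun s hs => (hSM hs).1
    choose! f hf using h
    obtain ⟨N, hN⟩ := (hSf.image f).bddAbove
    refine ⟨N, fun s hs n hn => hf s hs n ?_⟩
    have := hN (Set.mem_image_of_mem f hs)
    grind
  obtain ⟨N, hN⟩ := hN
  have hQ := isCompact_stay T hc (I := Set.Iio (-N : ℤ)) ⟨-N - 1, by simp⟩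
  refine ⟨(H : Set G) * stay T H (Set.Iio (-N : ℤ)), hc.mul hQ, ?_⟩
  -- Here `m` bounds how far back `x` can be outside `H`. While `m > N`, one left division lowers
  -- it.
  have key : ∀ m : ℕ, ∀ x ∈ eventuallyIn T H, x ∈ stay T H (Set.Iio (-m : ℤ)) →
      x ∈ (H : Set G) * stay T H (Set.Iio (-N : ℤ)) := by
    intro m
    induction m with
    | zero =>
      intro x _ hx
      refine ⟨1, H.one_mem, x, stay_anti T H (fun n hn => ?_) hx, one_mul x⟩
      simp only [Set.mem_Iio] at hn ⊢
      omega
    | succ m ih =>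
      intro x hxE hx
      by_cases hmN : m + 1 ≤ N
      · refine ⟨1, H.one_mem, x, stay_anti T H (fun n hn => ?_) hx, one_mul x⟩
        simp only [Set.mem_Iio] at hn ⊢
        omega
      -- The earliest possible bad time `-(m + 1)` is moved to time 0. Dividing by a coset
      -- representative `s` repairs it and keeps the earlier times good; moved back, `s` lies in `H`
      -- because `m + 1` exceeds `N`.
      · have hyM : iter T (-(m + 1 : ℤ)) x ∈ eventuallyIn T H ⊓ stay T H (Set.Iio 0) := by
          refine ⟨iter_mem_eventuallyIn hxE _, (iter_mem_stay _).2 fun n hn => hx _ ?_⟩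
          simp only [Set.mem_Iio] at hn ⊢
          push_cast
          omega
        obtain ⟨s, hs, hsx⟩ := hS _ hyM
        have hy := Subgroup.mul_mem _ (Subgroup.inv_mem _ (hSM hs)) hyM
        set y := s⁻¹ * iter T (-(m + 1 : ℤ)) x with hydef
        have hxy : x = iter T (m + 1 : ℤ) s * iter T (m + 1 : ℤ) y := by
          rw [← map_mul, hydef, mul_inv_cancel_left, iter_iter_neg]
        obtain ⟨h, hh, q, hq, hhq⟩ := ih (iter T (m + 1 : ℤ) y) (iter_mem_eventuallyIn hy.1 _) (by
          refine (iter_mem_stay _).2 fun n hn => ?_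
          rcases eq_or_ne (n + (m + 1 : ℤ)) 0 with h0 | h0
          · rwa [h0, iter_zero_apply]
          · refine hy.2 _ ?_
            simp only [Set.mem_Iio] at hn ⊢
            omega)
        refine ⟨iter T (m + 1 : ℤ) s * h, H.mul_mem (hN s hs _ (by omega)) hh, q, hq, ?_⟩
        rw [hxy, ← hhq]
        exact mul_assoc _ _ _
  rintro x ⟨M, hM⟩
  refine key M x ⟨M, hM⟩ fun n hn => hM n ?_
  simp only [Set.mem_Iio] at hn
  grind

theorem isCompact_Gt [T2Space G] (T : G ≃ₜ* G) {H : Subgroup G}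
    (hc : IsCompact (H : Set G)) (ho : IsOpen (H : Set G)) : IsCompact (Gt T H : Set G) := by
  obtain ⟨Q, hQ, hE⟩ := exists_eventuallyIn_subset T hc ho
  exact hQ.closure_of_subset hE

theorem iter_mem_Gt {T : G ≃ₜ* G} {H : Subgroup G} {g : G} (hg : g ∈ Gt T H) (n : ℤ) :
    iter T n g ∈ Gt T H :=
  map_mem_closure (continuous_iter T n) hg fun _ hx => iter_mem_eventuallyIn hx n

theorem Gt_le_Gc [T2Space G] (T : G ≃ₜ* G) {H : Subgroup G}
    (hc : IsCompact (H : Set G)) (ho : IsOpen (H : Set G)) : Gt T H ≤ Gc T := by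
  intro g hg
  refine subset_closure ((isCompact_Gt T hc ho).closure_of_subset ?_)
  rintro _ ⟨n, rfl⟩
  exact iter_mem_Gt hg n

end Compact

/-! ### Subgroups that split into past and future -/

section Tidy

variable {G : Type*} [Group G] [TopologicalSpace G]

/-- Every element of `V` is the product of an element whose past is in `V` and an element whose
future is in `V`. -/
def IsTidyAbove (T : G ≃ₜ* G) (V : Subgroup G) : Prop :=
  ∀ v ∈ V, ∃ p ∈ stay T V (Set.Iic 0), ∃ q ∈ stay T V (Set.Ici 0), v = p * q

/-- Time reversal exchanges the roles of the two factors, and splitting `v⁻¹` restores their order.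
-/
theorem IsTidyAbove.symm {T : G ≃ₜ* G} {V : Subgroup G} (h : IsTidyAbove T V) :
    IsTidyAbove T.symm V := by
  intro v hv
  obtain ⟨p, hp, q, hq, hpq⟩ := h v⁻¹ (V.inv_mem hv)
  refine ⟨q⁻¹, Subgroup.inv_mem _ fun n hn => ?_, p⁻¹, Subgroup.inv_mem _ fun n hn => ?_, ?_⟩
  · rw [iter_symm]
    exact hq _ (by simpa using hn)
  · rw [iter_symm]
    exact hp _ (by simpa using hn)
  · rw [← mul_inv_rev, ← hpq, inv_inv]

/-- If one step can be split off, then the subgroup is tidy above. -/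
theorem isTidyAbove_of_step [IsTopologicalGroup G] [T2Space G] {T : G ≃ₜ* G} {V : Subgroup G}
    (hc : IsCompact (V : Set G))
    (h : ∀ v ∈ V, ∃ p ∈ stay T V (Set.Iic 0), ∃ q ∈ V, T q ∈ V ∧ v = p * q) :
    IsTidyAbove T V := by
  have step : ∀ j : ℕ, ∀ v ∈ V, ∃ p ∈ stay T V (Set.Iic 0), ∃ q ∈ stay T V (Set.Icc 0 (j : ℤ)),
      v = p * q := by
    intro j
    induction j with
    | zero =>
      intro v hv
      refine ⟨1, Subgroup.one_mem _, v, fun n hn => ?_, (one_mul v).symm⟩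
      have : n = 0 := by simpa using hn
      simpa [this] using hv
    | succ j ih =>
      intro v hv
      obtain ⟨p, hp, w, hw, rfl⟩ := ih v hv
      -- One step is split off at time `j`. Moved back to time 0, `p'` stays in `V` up to time `j`,
      -- so it can be absorbed into `p` without spoiling the remaining factor on `[0, j]`.
      obtain ⟨p', hp', q, hq, hTq, hpq⟩ := h (iter T j w) (hw j (by simp))
      have hp'' : iter T (-j) p' ∈ stay T V (Set.Iic (j : ℤ)) := by
        refine (iter_mem_stay _).2 fun n hn => hp' _ ?_
        simp only [Set.mem_Iic] at hn ⊢
        omega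
      have hw' : w = iter T (-j) p' * iter T (-j) q := by
        rw [← map_mul, ← hpq, iter_neg_iter]
      refine ⟨p * iter T (-j) p', Subgroup.mul_mem _ hp (stay_anti T V ?_ hp''), iter T (-j) q,
        ?_, ?_⟩
      · intro n hn
        simp only [Set.mem_Iic] at hn ⊢
        omega
      · intro n hn
        rcases eq_or_ne n (j + 1) with rfl | hne
        · rw [← iter_add_apply, add_neg_cancel_comm, iter_one_apply]
          exact hTq
        · have hq' : iter T (-j) q = (iter T (-j) p')⁻¹ * w := by
            rw [hw', inv_mul_cancel_left]
          have hn' : 0 ≤ n ∧ n ≤ j := by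
            simp only [Set.mem_Icc] at hn
            push_cast at hn
            omega
          rw [hq']
          exact Subgroup.mul_mem _ (Subgroup.inv_mem _ (stay_anti T V
            (fun k hk => hk.2) hp'')) hw n hn'
      · rw [hw', mul_assoc]
  intro v hv
  -- The admissible second factors for horizon `j` form a decreasing sequence of nonempty compact
  -- sets; a common point serves all future times.
  have hcont : Continuous fun q : G => v * q⁻¹ := by fun_prop
  have hne := IsCompact.nonempty_iInter_of_sequence_nonempty_isCompact_isClosed
    (fun j : ℕ => (fun q : G => v * q⁻¹) ⁻¹' (stay T V (Set.Iic 0)) ∩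
      (stay T V (Set.Icc 0 (j : ℤ)) : Set G))
    (fun j => Set.inter_subset_inter_right _ (stay_anti T V (Set.Icc_subset_Icc le_rfl (by simp))))
    (fun j => by
      obtain ⟨p, hp, q, hq, rfl⟩ := step j v hv
      exact ⟨q, by simpa using hp, hq⟩)
    ((isCompact_stay T hc ⟨0, by simp⟩).inter_left
      ((isClosed_stay T hc.isClosed _).preimage hcont))
    (fun j => ((isClosed_stay T hc.isClosed _).preimage hcont).inter
      (isClosed_stay T hc.isClosed _))
  obtain ⟨q, hq⟩ := hne
  rw [Set.mem_iInter] at hq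
  refine ⟨v * q⁻¹, (hq 0).1, q, fun n hn => (hq n.toNat).2 n ⟨hn, ?_⟩, by simp⟩
  exact Int.self_le_toNat n

/-- Every compact open subgroup contains an open subgroup that is tidy above. -/
theorem exists_isTidyAbove [IsTopologicalGroup G] [T2Space G] (T : G ≃ₜ* G) {H : Subgroup G}
    (hc : IsCompact (H : Set G)) (ho : IsOpen (H : Set G)) :
    ∃ V ≤ H, IsOpen (V : Set G) ∧ IsTidyAbove T V := by
  -- The finite-past subgroups decrease to `stay T H (Set.Iic (-1))`, which lies in the open set
  -- `U`; so some finite past of length `n + 1` already lies in `U`.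
  obtain ⟨n, hn⟩ := exists_subset_nhds_of_isCompact
    (V := fun n : ℕ => (stay T H (Set.Icc (-n - 1 : ℤ) (-1)) : Set G))
    (U := (stay T H (Set.Iic (-1)) : Set G) * (H : Set G))
    (directed_of_isDirected_le fun a b hab => stay_anti T H (Set.Icc_subset_Icc (by omega) le_rfl))
    (fun n => isCompact_stay T hc ⟨-1, by simp⟩)
    (fun x hx => ho.mul_left.mem_nhds ⟨x, fun k hk => Set.mem_iInter.1 hx k.natAbs k (by
      simp only [Set.mem_Iic, Set.mem_Icc] at hk ⊢
      omega), 1, H.one_mem, mul_one x⟩)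
  have hVH : stay T H (Set.Icc (-n : ℤ) 0) ≤ H := fun g hg => by
    simpa using hg 0 (by simp)
  have hVc : IsCompact (stay T H (Set.Icc (-n : ℤ) 0) : Set G) :=
    isCompact_stay T hc ⟨0, by simp⟩
  refine ⟨stay T H (Set.Icc (-n : ℤ) 0), hVH, isOpen_stay T ho (Set.finite_Icc _ _),
    isTidyAbove_of_step hVc fun v hv => ?_⟩
  have hTv : iter T 1 v ∈ stay T H (Set.Icc (-n - 1 : ℤ) (-1)) :=
    (iter_mem_stay 1).2 fun k hk => hv _ (by simp only [Set.mem_Icc] at hk ⊢; omega)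
  obtain ⟨y, hy, h, hh, hyh⟩ := hn hTv
  dsimp only at hyh
  have hh' : h ∈ stay T H (Set.Icc (-n - 1 : ℤ) (-1)) := by
    have : h = y⁻¹ * iter T 1 v := by rw [← hyh, inv_mul_cancel_left]
    rw [this]
    exact Subgroup.mul_mem _ (Subgroup.inv_mem _ (stay_anti T H (fun k hk => hk.2) hy)) hTv
  have hTq : iter T 1 (iter T (-1) h) = h := iter_iter_neg T 1 h
  refine ⟨iter T (-1) y, ?_, iter T (-1) h, ?_, ?_, ?_⟩
  · refine (iter_mem_stay _).2 fun k hk => ?_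
    rw [iter_add_apply]
    intro i hi
    rw [← iter_add_apply, ← iter_add_apply]
    refine hy _ ?_
    simp only [Set.mem_Iic, Set.mem_Icc] at *
    omega
  · refine (iter_mem_stay _).2 fun k hk => hh' _ ?_
    simp only [Set.mem_Icc] at *
    omega
  · rw [← iter_one_apply, hTq]
    intro k hk
    rcases eq_or_ne k 0 with rfl | hk0
    · simpa using hh
    · refine hh' _ ?_
      simp only [Set.mem_Icc] at *
      omega
  · rw [← map_mul, hyh, iter_neg_iter]

end Tidy

/-! ### Time reversal -/

section Symm

variable {G : Type*} [Group G] [TopologicalSpace G]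

theorem orbit_symm (T : G ≃ₜ* G) (g : G) : orbit T.symm g = orbit T g := by
  ext x
  simp only [orbit, Set.mem_range, iter_symm]
  exact (Equiv.neg ℤ).exists_congr_left.trans (by simp)

theorem eventuallyIn_symm (T : G ≃ₜ* G) (H : Subgroup G) :
    eventuallyIn T.symm H = eventuallyIn T H := by
  ext g
  simp only [mem_eventuallyIn, iter_symm]
  refine exists_congr fun N => ⟨fun h n hn => ?_, fun h n hn => h (-n) (by rwa [abs_neg])⟩
  simpa using h (-n) (by rwa [abs_neg])

theorem SeparatesPoints.symm {T : G ≃ₜ* G} {U : Set G} (h : SeparatesPoints T U) :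
    SeparatesPoints T.symm U := by
  intro g k hgk
  obtain ⟨n, hn⟩ := h g k hgk
  exact ⟨-n, by simpa [iter_symm] using hn⟩

theorem SeparatesPoints.mono {T : G ≃ₜ* G} {U V : Set G} (h : SeparatesPoints T U) (hVU : V ⊆ U) :
    SeparatesPoints T V := by
  intro g k hgk
  obtain ⟨n, hn⟩ := h g k hgk
  exact ⟨n, fun hmem => hn (Set.smul_set_mono hVU hmem)⟩

end Symm

/-! ### Points with relatively compact orbit close to the identity -/

section BoundedOrbits

variable {G : Type*} [Group G] [TopologicalSpace G] [IsTopologicalGroup G]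

theorem mem_compactOrbitPoints {T : G ≃ₜ* G} {g : G} :
    g ∈ compactOrbitPoints T ↔ IsCompact (closure (orbit T g)) := Iff.rfl

theorem compactOrbitPoints_symm (T : G ≃ₜ* G) :
    compactOrbitPoints T.symm = compactOrbitPoints T := by
  ext g
  rw [mem_compactOrbitPoints, mem_compactOrbitPoints, orbit_symm]

theorem Gt_symm (T : G ≃ₜ* G) (H : Subgroup G) : Gt T.symm H = Gt T H := by
  rw [Gt, eventuallyIn_symm, Gt]

/-- A point with past in a tidy subgroup and with bounded orbit is a limit of homoclinic points. -/
theorem mem_Gt_of_past_mem [T2Space G] {T : G ≃ₜ* G} {V : Subgroup G}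
    (hc : IsCompact (V : Set G)) (ho : IsOpen (V : Set G)) (hs : SeparatesPoints T (V : Set G))
    (ht : IsTidyAbove T V) {a : G} (ha : a ∈ stay T V (Set.Iic 0))
    (hb : a ∈ compactOrbitPoints T) : a ∈ Gt T V := by
  change a ∈ closure (eventuallyIn T V : Set G)
  rw [mem_closure_iff_nhds]
  intro U hU
  have hcont : Filter.Tendsto (fun x : G × G => x.1⁻¹ * a * x.2⁻¹) (nhds 1 ×ˢ nhds 1)
      (nhds a) := by
    have h : Continuous fun x : G × G => x.1⁻¹ * a * x.2⁻¹ := by fun_prop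
    simpa [nhds_prod_eq] using h.tendsto (1, 1)
  obtain ⟨W₁, hW₁, W₂, hW₂, hW⟩ := Filter.mem_prod_iff.1 (hcont hU)
  obtain ⟨D, hD⟩ := exists_stay_subset T hc hs (Filter.inter_mem hW₁ hW₂)
  have hfin := finite_image_mk_of_isCompact ho hb
  -- The orbit meets finitely many cosets of `V`. Sampling at multiples of `D + 1` makes the two
  -- coinciding times differ by more than `D`.
  obtain ⟨i, -, j, -, hij, hmk⟩ := Set.infinite_univ.exists_lt_map_eq_of_mapsTo
    (f := fun i : ℕ => (QuotientGroup.mk (iter T (i * (D + 1) : ℕ) a) : G ⧸ V))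
    (fun i _ => Set.mem_image_of_mem _ (subset_closure (Set.mem_range_self _))) hfin
  obtain ⟨n, hn⟩ : ∃ n : ℕ, n = i * (D + 1) := ⟨_, rfl⟩
  obtain ⟨m, hm⟩ : ∃ m : ℕ, m = j * (D + 1) := ⟨_, rfl⟩
  have hnm : n + D + 1 ≤ m := by
    rw [hn, hm]
    calc i * (D + 1) + D + 1 = (i + 1) * (D + 1) := by ring
      _ ≤ j * (D + 1) := Nat.mul_le_mul_right _ hij
  simp only [← hn, ← hm] at hmk
  have hv := QuotientGroup.eq.1 hmk
  set v := (iter T n a)⁻¹ * iter T m a with hvdef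
  have hvpast : v ∈ stay T V (Set.Iic (-m : ℤ)) := by
    refine Subgroup.mul_mem _ (Subgroup.inv_mem _ ?_) ?_
    all_goals
      refine (iter_mem_stay _).2 fun k hk => ha _ ?_
      simp only [Set.mem_Iic] at *
      omega
  -- Then `q⁻¹ = v * p` is homoclinic: its future is good through `q`, and its distant past through
  -- `v` and `p`.
  obtain ⟨p, hp, q, hq, hpq⟩ := ht v⁻¹ (V.inv_mem hv)
  have hu : q⁻¹ = v * p := by rw [← inv_inv v, hpq]; group
  have huE : q⁻¹ ∈ eventuallyIn T V := by
    refine ⟨m, fun k hk => ?_⟩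
    rcases le_total 0 k with h0 | h0
    · exact Subgroup.inv_mem (stay T V (Set.Ici 0)) hq k h0
    · rw [hu, map_mul]
      rw [abs_of_nonpos h0] at hk
      exact V.mul_mem (hvpast k (by simp only [Set.mem_Iic]; omega)) (hp k h0)
  -- The homoclinic point `iter T (-m) q⁻¹` equals `t⁻¹ * a * w⁻¹`. Both errors are small, since
  -- they are iterates of points with past in `V`, shifted back by more than `D`.
  set t := iter T (n - m : ℤ) a with htdef
  set w := iter T (-m : ℤ) p⁻¹ with hwdef
  have htD : t ∈ stay T V (Set.Icc (-D : ℤ) D) := by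
    refine (iter_mem_stay _).2 fun k hk => ha _ ?_
    simp only [Set.mem_Iic, Set.mem_Icc] at *
    omega
  have hwD : w ∈ stay T V (Set.Icc (-D : ℤ) D) := by
    refine (iter_mem_stay _).2 fun k hk => Subgroup.inv_mem _ hp _ ?_
    simp only [Set.mem_Iic, Set.mem_Icc] at *
    omega
  have hU' : t⁻¹ * a * w⁻¹ ∈ U := hW (Set.mk_mem_prod (hD htD).1 (hD hwD).2)
  refine ⟨_, hU', ?_⟩
  have he : t⁻¹ * a * w⁻¹ = iter T (-m : ℤ) q⁻¹ := by
    have h1 : iter T (-m : ℤ) v = t⁻¹ * a := by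
      rw [hvdef, map_mul, map_inv, ← iter_add_apply, iter_neg_iter, htdef, neg_add_eq_sub]
    rw [hu, map_mul, h1, hwdef, map_inv, inv_inv]
  rw [he]
  exact iter_mem_eventuallyIn huE _

/-- The past of `p` is in `V`, and its future is the orbit of `p * q` corrected by elements of `V`.
-/
theorem mem_compactOrbitPoints_of_mul {T : G ≃ₜ* G} {V : Subgroup G}
    (hc : IsCompact (V : Set G)) [T2Space G] {p q : G} (hp : p ∈ stay T V (Set.Iic 0))
    (hq : q ∈ stay T V (Set.Ici 0)) (h : p * q ∈ compactOrbitPoints T) :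
    p ∈ compactOrbitPoints T := by
  refine (hc.union ((mem_compactOrbitPoints.1 h).mul hc)).closure_of_subset ?_
  rintro _ ⟨n, rfl⟩
  rcases le_total n 0 with h0 | h0
  · exact Or.inl (hp n h0)
  · refine Or.inr ⟨iter T n (p * q), subset_closure ⟨n, rfl⟩, (iter T n q)⁻¹,
      V.inv_mem (hq n h0), ?_⟩
    simp

theorem inf_compactOrbitPoints_le_Gt [T2Space G] {T : G ≃ₜ* G} {V : Subgroup G}
    (hc : IsCompact (V : Set G)) (ho : IsOpen (V : Set G)) (hs : SeparatesPoints T (V : Set G))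
    (ht : IsTidyAbove T V) : V ⊓ compactOrbitPoints T ≤ Gt T V := by
  rintro g ⟨hgV, hgC⟩
  obtain ⟨p, hp, q, hq, rfl⟩ := ht g hgV
  have hpC := mem_compactOrbitPoints_of_mul hc hp hq hgC
  have hqC : q ∈ compactOrbitPoints T := by
    simpa using Subgroup.mul_mem _ (Subgroup.inv_mem _ hpC) hgC
  refine Subgroup.mul_mem _ (mem_Gt_of_past_mem hc ho hs ht hp hpC) ?_
  rw [← Gt_symm]
  rw [← compactOrbitPoints_symm] at hqC
  refine mem_Gt_of_past_mem hc ho hs.symm ht.symm (fun n hn => ?_) hqC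
  rw [iter_symm]
  exact hq _ (by simpa using hn)

/-- Some open subgroup of `G` meets `G_c` inside `G_t`. -/
theorem exists_inf_Gc_le_Gt [T2Space G] (T : G ≃ₜ* G) {H : Subgroup G}
    (hc : IsCompact (H : Set G)) (ho : IsOpen (H : Set G)) (hs : SeparatesPoints T (H : Set G)) :
    ∃ V : Subgroup G, IsOpen (V : Set G) ∧ V ⊓ Gc T ≤ Gt T H := by
  obtain ⟨V, hVH, hVo, ht⟩ := exists_isTidyAbove T hc ho
  have hVc : IsCompact (V : Set G) := hc.of_isClosed_subset (V.isClosed_of_isOpen hVo) hVH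
  have hle := inf_compactOrbitPoints_le_Gt hVc hVo (hs.mono hVH) ht
  refine ⟨V, hVo, fun g hg => ?_⟩
  have h1 : g ∈ closure ((V : Set G) ∩ compactOrbitPoints T) :=
    hVo.inter_closure ⟨hg.1, hg.2⟩
  have h2 : closure ((V : Set G) ∩ compactOrbitPoints T) ⊆ Gt T V :=
    closure_minimal hle isClosed_closure
  exact closure_mono (eventuallyIn_mono T hVH) (h2 h1)

theorem isOpen_Gt_subgroupOf_Gc [T2Space G] (T : G ≃ₜ* G) {H : Subgroup G}
    (hc : IsCompact (H : Set G)) (ho : IsOpen (H : Set G)) (hs : SeparatesPoints T (H : Set G)) :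
    IsOpen (((Gt T H).subgroupOf (Gc T) : Subgroup (Gc T)) : Set (Gc T)) := by
  obtain ⟨V, hVo, hV⟩ := exists_inf_Gc_le_Gt T hc ho hs
  refine Subgroup.isOpen_of_mem_nhds _ (g := 1) ?_
  filter_upwards [(hVo.preimage continuous_subtype_val).mem_nhds V.one_mem] with x hx
  exact hV ⟨hx, x.2⟩

end BoundedOrbits

/-! ### Sections compatible with a filtration -/

section Section

/-- A filtration of a group has a section over its image that is compatible with all levels up to
the `n`-th. -/
theorem exists_filtered_section {P A : Type*} [Group P] [Group A] (π : P →* A)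
    (X : ℕ → Subgroup P) (hX : Monotone X) (h0 : X 0 = ⊥) (n : ℕ) :
    ∃ g : A → P, g 1 = 1 ∧ (∀ a ∈ (X n).map π, π (g a) = a) ∧
      ∀ i ≤ n, ∀ a ∈ (X n).map π, ∀ b ∈ (X n).map π, a⁻¹ * b ∈ (X i).map π →
        (g a)⁻¹ * g b ∈ X i := by
  induction n with
  | zero =>
    refine ⟨fun _ => 1, rfl, fun a ha => ?_, fun i _ a _ b _ _ => by simp⟩
    rw [h0, Subgroup.map_bot, Subgroup.mem_bot] at ha
    rw [ha, map_one]
  | succ n ih =>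
    obtain ⟨g, hg1, hgπ, hg⟩ := ih
    -- Lifted coset representatives. The trivial coset gets 1, to keep `g 1 = 1`; cosets not met by
    -- the image of `X (n + 1)` get an irrelevant default.
    have hρ : ∀ c : A ⧸ (X n).map π, ∃ x : P, (c = QuotientGroup.mk 1 → x = 1) ∧
        ((∃ y ∈ X (n + 1), QuotientGroup.mk (π y) = c) →
          x ∈ X (n + 1) ∧ QuotientGroup.mk (π x) = c) := by
      intro c
      by_cases hc : c = QuotientGroup.mk 1
      · exact ⟨1, fun _ => rfl, fun _ => ⟨Subgroup.one_mem _, by rw [map_one, hc]⟩⟩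
      · by_cases h : ∃ y ∈ X (n + 1), QuotientGroup.mk (π y) = c
        · obtain ⟨y, hy⟩ := h
          exact ⟨y, fun h => absurd h hc, fun _ => hy⟩
        · exact ⟨1, fun _ => rfl, fun h' => absurd h' h⟩
    choose ρ hρ1 hρ2 using hρ
    have hρX : ∀ a ∈ (X (n + 1)).map π, ρ (QuotientGroup.mk a) ∈ X (n + 1) ∧
        (π (ρ (QuotientGroup.mk a)))⁻¹ * a ∈ (X n).map π := by
      rintro _ ⟨y, hy, rfl⟩
      obtain ⟨h1, h2⟩ := hρ2 _ ⟨y, hy, rfl⟩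
      exact ⟨h1, QuotientGroup.eq.1 h2⟩
    have hgX : ∀ a ∈ (X n).map π, g a ∈ X n := fun a ha => by
      simpa [hg1] using hg n le_rfl 1 (Subgroup.one_mem _) a ha (by simpa using ha)
    -- Within one left coset the factor `ρ` cancels from `(g a)⁻¹ * g b`, so the levels up to `n`
    -- reduce to the old section.
    refine ⟨fun a => ρ (QuotientGroup.mk a) * g ((π (ρ (QuotientGroup.mk a)))⁻¹ * a), ?_, ?_, ?_⟩
    · simp [hρ1, hg1]
    · intro a ha
      rw [map_mul, hgπ _ (hρX a ha).2, mul_inv_cancel_left]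
    · intro i hi a ha b hb hab
      rcases Nat.lt_or_ge n i with hni | hni
      · obtain rfl : i = n + 1 := by omega
        have hmem : ∀ c ∈ (X (n + 1)).map π,
            ρ (QuotientGroup.mk c) * g ((π (ρ (QuotientGroup.mk c)))⁻¹ * c) ∈ X (n + 1) :=
          fun c hc => Subgroup.mul_mem _ (hρX c hc).1 (hX n.le_succ (hgX _ (hρX c hc).2))
        exact Subgroup.mul_mem _ (Subgroup.inv_mem _ (hmem a ha)) (hmem b hb)
      · have hmk : (QuotientGroup.mk a : A ⧸ (X n).map π) = QuotientGroup.mk b :=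
          QuotientGroup.eq.2 (Subgroup.map_mono (hX hni) hab)
        have ha' := (hρX a ha).2
        have hb' := (hρX b hb).2
        rw [← hmk] at hb'
        dsimp only
        rw [← hmk]
        have h := hg i hni _ ha' _ hb' (by
          rw [mul_inv_rev, inv_inv, mul_assoc, mul_inv_cancel_left]
          exact hab)
        rwa [mul_inv_rev, mul_assoc, inv_mul_cancel_left]

end Section

/-! ### Ordered products over integer windows -/

section WindowProd

variable {A : Type*} [Group A]

/-- The ordered product `f a * f (a + 1) * ⋯ * f (a + m - 1)`. -/
def windowProd (f : ℤ → A) (a : ℤ) : ℕ → A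
  | 0 => 1
  | m + 1 => f a * windowProd f (a + 1) m

theorem windowProd_congr {f f' : ℤ → A} {a : ℤ} {m : ℕ}
    (h : ∀ k, a ≤ k → k < a + m → f k = f' k) : windowProd f a m = windowProd f' a m := by
  induction m generalizing a with
  | zero => rfl
  | succ m ih =>
    rw [windowProd, windowProd, h a le_rfl (by omega),
      ih fun k h1 h2 => h k (by omega) (by push_cast; omega)]

theorem windowProd_eq_one {f : ℤ → A} {a : ℤ} {m : ℕ}
    (h : ∀ k, a ≤ k → k < a + m → f k = 1) : windowProd f a m = 1 := by
  induction m generalizing a with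
  | zero => rfl
  | succ m ih =>
    rw [windowProd, h a le_rfl (by omega), one_mul,
      ih fun k h1 h2 => h k (by omega) (by push_cast; omega)]

theorem windowProd_add (f : ℤ → A) (a : ℤ) (m n : ℕ) :
    windowProd f a (m + n) = windowProd f a m * windowProd f (a + m) n := by
  induction m generalizing a with
  | zero => simp [windowProd]
  | succ m ih =>
    rw [Nat.succ_add, windowProd, ih, windowProd, mul_assoc]
    push_cast
    rw [add_assoc, add_comm (1 : ℤ)]

theorem windowProd_succ_last (f : ℤ → A) (a : ℤ) (m : ℕ) :
    windowProd f a (m + 1) = windowProd f a m * f (a + m) := by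
  rw [windowProd_add]
  simp [windowProd]

theorem windowProd_shift (f : ℤ → A) (a : ℤ) (m : ℕ) :
    windowProd (fun k => f (k + 1)) a m = windowProd f (a + 1) m := by
  induction m generalizing a with
  | zero => rfl
  | succ m ih => rw [windowProd, windowProd, ih]

/-- Enlarging the window by trivial factors does not change the product. -/
theorem windowProd_of_support {f : ℤ → A} {a b : ℤ} {m n : ℕ} (hab : a ≤ b)
    (hmn : b + n ≤ a + m) (h : ∀ k, k < b ∨ b + n ≤ k → f k = 1) :
    windowProd f a m = windowProd f b n := by
  obtain ⟨p, rfl⟩ : ∃ p : ℕ, b = a + p := ⟨(b - a).toNat, by omega⟩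
  obtain ⟨q, rfl⟩ : ∃ q : ℕ, m = p + (n + q) := ⟨m - (p + n), by omega⟩
  rw [windowProd_add, windowProd_add, windowProd_eq_one fun k _ h2 => h k (Or.inl h2), one_mul,
    windowProd_eq_one fun k h1 _ => h k (Or.inr h1), mul_one]

theorem continuous_windowProd [TopologicalSpace A] [ContinuousMul A] {Y : Type*}
    [TopologicalSpace Y] {f : Y → ℤ → A} (hf : ∀ k, Continuous fun y => f y k) (a : ℤ) (m : ℕ) :
    Continuous fun y => windowProd (f y) a m := by
  induction m generalizing a with
  | zero => exact continuous_const
  | succ m ih => exact (hf a).mul (ih _)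

theorem windowProd_mem {X : Subgroup (ℤ → A)} {u : ℤ → ℤ → A} (hu : ∀ k, u k ∈ X) (a : ℤ)
    (m : ℕ) : (fun t => windowProd (fun k => u k t) a m) ∈ X := by
  induction m generalizing a with
  | zero => exact X.one_mem
  | succ m ih => exact X.mul_mem (hu a) (ih _)

end WindowProd

/-! ### Group shifts with dense finitely supported points are full shifts -/

section Encoder

variable {A : Type*} [Group A]

/-- The elements of `X` supported in `[0, j)`. -/
def supportedIn (X : Subgroup (ℤ → A)) (j : ℕ) : Subgroup (ℤ → A) where
  carrier := {x | x ∈ X ∧ ∀ t : ℤ, t < 0 ∨ (j : ℤ) ≤ t → x t = 1}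
  one_mem' := ⟨X.one_mem, fun _ _ => rfl⟩
  mul_mem' ha hb := ⟨X.mul_mem ha.1 hb.1, fun t ht => by
    rw [Pi.mul_apply, ha.2 t ht, hb.2 t ht, mul_one]⟩
  inv_mem' ha := ⟨X.inv_mem ha.1, fun t ht => by rw [Pi.inv_apply, ha.2 t ht, inv_one]⟩

/-- The values at time `0` of the elements of `X` supported in `[0, j)`. -/
def leading (X : Subgroup (ℤ → A)) (j : ℕ) : Subgroup A :=
  (supportedIn X j).map (Pi.evalMonoidHom (fun _ : ℤ => A) 0)

theorem supportedIn_mono (X : Subgroup (ℤ → A)) : Monotone (supportedIn X) :=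
  fun _ _ hij _ hx => ⟨hx.1, fun t ht => hx.2 t (by omega)⟩

theorem supportedIn_zero (X : Subgroup (ℤ → A)) : supportedIn X 0 = ⊥ := by
  refine (Subgroup.eq_bot_iff_forall _).2 fun x hx => funext fun t => hx.2 t ?_
  push_cast
  omega

theorem leading_mono (X : Subgroup (ℤ → A)) : Monotone (leading X) :=
  fun _ _ hij => Subgroup.map_mono (supportedIn_mono X hij)

theorem mem_leading_of_mem {X : Subgroup (ℤ → A)} {j : ℕ} {x : ℤ → A}
    (hx : x ∈ supportedIn X j) : x 0 ∈ leading X j := ⟨x, hx, rfl⟩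

/-- A system of generators of `X` of span at most `n + 1`, one for each leading value, which is
minimal in the sense that it is compatible with the filtration by spans. -/
structure Generators (X : Subgroup (ℤ → A)) (n : ℕ) (g : A → ℤ → A) : Prop where
  leading_le : ∀ i, leading X i ≤ leading X (n + 1)
  map_one : g 1 = 1
  apply_zero : ∀ a ∈ leading X (n + 1), g a 0 = a
  inv_mul_mem : ∀ i, ∀ a ∈ leading X (n + 1), ∀ b ∈ leading X (n + 1), a⁻¹ * b ∈ leading X i →
    (g a)⁻¹ * g b ∈ supportedIn X i

/-- The increasing chain of leading subgroups of a finite group stabilises, so generators of bounded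
span realise every leading value. -/
theorem exists_generators [Finite A] (X : Subgroup (ℤ → A)) : ∃ n g, Generators X n g := by
  obtain ⟨n, hn⟩ := WellFoundedGT.monotone_chain_condition
    (⟨leading X, leading_mono X⟩ : ℕ →o Subgroup A)
  replace hn : ∀ m, n ≤ m → leading X n = leading X m := hn
  obtain ⟨g, hg1, hgπ, hg⟩ := exists_filtered_section (Pi.evalMonoidHom (fun _ : ℤ => A) 0)
    (supportedIn X) (supportedIn_mono X) (supportedIn_zero X) (n + 1)
  have hle : ∀ i, leading X i ≤ leading X (n + 1) := fun i => by
    rcases le_total i (n + 1) with h | h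
    · exact leading_mono X h
    · rw [← hn i (by omega), ← hn (n + 1) (by omega)]
  refine ⟨n, g, hle, hg1, hgπ, fun i a ha b hb hab => ?_⟩
  rcases le_total i (n + 1) with h | h
  · exact hg i h a ha b hb hab
  · exact supportedIn_mono X h (hg (n + 1) le_rfl a ha b hb (hle i hab))

namespace Generators

variable {X : Subgroup (ℤ → A)} {n : ℕ} {g : A → ℤ → A}

theorem mem_supportedIn_of_mem (hg : Generators X n g) {i : ℕ} {a : A} (ha : a ∈ leading X i) :
    g a ∈ supportedIn X i := by
  simpa [hg.map_one] using hg.inv_mul_mem i 1 (Subgroup.one_mem _) a (hg.leading_le i ha)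
    (by simpa using ha)

end Generators

/-- The encoder: the ordered product over `k ∈ ℤ` of the generators `g (s k)` started at time
`k`. -/
def encode (n : ℕ) (g : A → ℤ → A) (s : ℤ → A) (t : ℤ) : A :=
  -- Generators supported in `[0, n + 1)` contribute at time `t` only for `t - n ≤ k ≤ t`.
  windowProd (fun k => g (s k) (t - k)) (t - n) (n + 1)

theorem encode_congr {n : ℕ} {g : A → ℤ → A} {s s' : ℤ → A} {t : ℤ}
    (h : ∀ k ≤ t, g (s k) (t - k) = g (s' k) (t - k)) : encode n g s t = encode n g s' t :=
  windowProd_congr fun k _ h2 => h k (by push_cast at h2; omega)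

theorem encode_shift (n : ℕ) (g : A → ℤ → A) (s : ℤ → A) (t : ℤ) :
    encode n g (fun k => s (k + 1)) t = encode n g s (t + 1) := by
  unfold encode
  rw [show t + 1 - (n : ℤ) = t - n + 1 by ring, ← windowProd_shift]
  simp only [add_sub_add_right_eq_sub]

theorem continuous_encode [TopologicalSpace A] [DiscreteTopology A] (n : ℕ) (g : A → ℤ → A) :
    Continuous (encode n g) :=
  continuous_pi fun _ => continuous_windowProd
    (fun k => (continuous_of_discreteTopology (f := fun a => g a _)).comp (continuous_apply k)) _ _

namespace Generators

variable {X : Subgroup (ℤ → A)} {n : ℕ} {g : A → ℤ → A}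

theorem apply_eq_one (hg : Generators X n g) {s : ℤ → A} (hs : ∀ k, s k ∈ leading X (n + 1))
    {t k : ℤ} (h : k < t - n ∨ t < k) : g (s k) (t - k) = 1 :=
  (hg.mem_supportedIn_of_mem (hs k)).2 _ (by push_cast; omega)

theorem encode_eq_windowProd (hg : Generators X n g) {s : ℤ → A}
    (hs : ∀ k, s k ∈ leading X (n + 1)) {t a : ℤ} {m : ℕ} (h1 : a ≤ t - n) (h2 : t < a + m) :
    encode n g s t = windowProd (fun k => g (s k) (t - k)) a m := by
  refine (windowProd_of_support h1 (by push_cast; omega) fun k hk => ?_).symm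
  exact hg.apply_eq_one hs (by push_cast at hk; omega)

theorem translate_mem (hinv : ∀ x ∈ X, ∀ k : ℤ, (fun t => x (t + k)) ∈ X)
    (hg : Generators X n g) {s : ℤ → A} (hs : ∀ k, s k ∈ leading X (n + 1)) (k : ℤ) :
    (fun t => g (s k) (t - k)) ∈ X :=
  hinv _ (hg.mem_supportedIn_of_mem (hs k)).1 (-k)

theorem encode_mem [TopologicalSpace A] (hX : IsClosed (X : Set (ℤ → A)))
    (hinv : ∀ x ∈ X, ∀ k : ℤ, (fun t => x (t + k)) ∈ X) (hg : Generators X n g) {s : ℤ → A}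
    (hs : ∀ k, s k ∈ leading X (n + 1)) : encode n g s ∈ X := by
  refine hX.mem_of_tendsto (b := Filter.atTop)
    (f := fun N : ℕ => fun t => windowProd (fun k => g (s k) (t - k)) (-N) (2 * N)) ?_
    (Filter.Eventually.of_forall fun N => windowProd_mem (hg.translate_mem hinv hs) _ _)
  refine tendsto_pi_nhds.2 fun t => tendsto_const_nhds.congr' ?_
  filter_upwards [Filter.eventually_ge_atTop (t.natAbs + n + 1)] with N hN
  exact hg.encode_eq_windowProd hs (by omega) (by push_cast; omega)

/-- Every element of `X` of finite support is an ordered product of generators. -/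
theorem exists_windowProd_eq (hinv : ∀ x ∈ X, ∀ k : ℤ, (fun t => x (t + k)) ∈ X)
    (hg : Generators X n g) (m : ℕ) (a : ℤ) {x : ℤ → A} (hx : x ∈ X)
    (hsupp : ∀ t, t < a ∨ a + m ≤ t → x t = 1) :
    ∃ s : ℤ → A, (∀ k, s k ∈ leading X (n + 1)) ∧ (∀ k, k < a ∨ a + m ≤ k → s k = 1) ∧
      ∀ t, windowProd (fun k => g (s k) (t - k)) a m = x t := by
  induction m generalizing a x with
  | zero =>
    refine ⟨fun _ => 1, fun _ => Subgroup.one_mem _, fun _ _ => rfl, fun t => ?_⟩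
    rw [hsupp t (by push_cast; omega), windowProd]
  | succ m ih =>
    -- The generator for `x a` spans at most `m + 1`, by minimality. Dividing by it clears time `a`
    -- without enlarging the support on the right.
    have hlead : x a ∈ leading X (m + 1) := by
      have h : (fun t => x (t + a)) ∈ supportedIn X (m + 1) :=
        ⟨hinv x hx a, fun t ht => hsupp _ (by omega)⟩
      simpa using mem_leading_of_mem h
    have hgx := hg.mem_supportedIn_of_mem hlead
    obtain ⟨s, hs, hs1, hsx⟩ := ih (a + 1) (x := (fun t => g (x a) (t - a))⁻¹ * x)
      (X.mul_mem (X.inv_mem (hinv _ hgx.1 (-a))) hx) (fun t ht => by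
        rw [Pi.mul_apply, Pi.inv_apply]
        rcases eq_or_ne t a with rfl | hta
        · rw [sub_self, hg.apply_zero _ (hg.leading_le _ hlead), inv_mul_cancel]
        · rw [hgx.2 (t - a) (by push_cast; omega), hsupp t (by push_cast; omega), inv_one,
            one_mul])
    refine ⟨Function.update s a (x a), fun k => ?_, fun k hk => ?_, fun t => ?_⟩
    · rcases eq_or_ne k a with rfl | hka
      · rw [Function.update_self]
        exact hg.leading_le _ hlead
      · rw [Function.update_of_ne hka]
        exact hs k
    · push_cast at hk
      rw [Function.update_of_ne (by omega)]
      exact hs1 k (by omega)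
    · rw [windowProd, Function.update_self, windowProd_congr (f' := fun k => g (s k) (t - k)),
        hsx t, Pi.mul_apply, Pi.inv_apply, mul_inv_cancel_left]
      intro k hk _
      rw [Function.update_of_ne (by omega)]

theorem exists_encode_eq (hinv : ∀ x ∈ X, ∀ k : ℤ, (fun t => x (t + k)) ∈ X)
    (hg : Generators X n g) {x : ℤ → A} (hx : x ∈ X) {N : ℕ}
    (hsupp : ∀ t : ℤ, (N : ℤ) ≤ |t| → x t = 1) :
    ∃ s : ℤ → A, (∀ k, s k ∈ leading X (n + 1)) ∧ encode n g s = x := by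
  obtain ⟨s, hs, hs1, hsx⟩ := hg.exists_windowProd_eq hinv (2 * N) (-N) hx
    (fun t ht => hsupp t (by push_cast at ht; grind))
  refine ⟨s, hs, funext fun t => ?_⟩
  rw [← hsx t, hg.encode_eq_windowProd hs (a := -(t.natAbs + n + N : ℕ))
    (m := 2 * (t.natAbs + n + N + 1)) (by omega) (by omega)]
  refine windowProd_of_support (by omega) (by omega) fun k hk => ?_
  rw [hs1 k hk, hg.map_one, Pi.one_apply]

/-- The image is compact and contains the dense set of finitely supported elements. -/
theorem surjOn_encode [TopologicalSpace A] [DiscreteTopology A] [Finite A]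
    (hinv : ∀ x ∈ X, ∀ k : ℤ, (fun t => x (t + k)) ∈ X)
    (hd : (X : Set (ℤ → A)) ⊆ closure {x | x ∈ X ∧ ∃ N : ℕ, ∀ t : ℤ, (N : ℤ) ≤ |t| → x t = 1})
    (hg : Generators X n g) :
    Set.SurjOn (encode n g) {s | ∀ k, s k ∈ leading X (n + 1)} X := by
  have hc : IsCompact (encode n g '' {s | ∀ k, s k ∈ leading X (n + 1)}) := by
    refine IsCompact.image (IsClosed.isCompact ?_) (continuous_encode n g)
    rw [Set.ofPred_forall]
    exact isClosed_iInter fun k =>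
      (isClosed_discrete (leading X (n + 1) : Set A)).preimage (continuous_apply k)
  refine hd.trans (closure_minimal ?_ hc.isClosed)
  rintro x ⟨hx, N, hN⟩
  exact hg.exists_encode_eq hinv hx hN

/-- Descending induction on `i` puts all the differences `(s k)⁻¹ * s' k` in `leading X i`; at `i =
0` this group is trivial. Each step compares the encodings of the two pasts before `k`. -/
theorem injOn_encode [TopologicalSpace A] (hX : IsClosed (X : Set (ℤ → A)))
    (hinv : ∀ x ∈ X, ∀ k : ℤ, (fun t => x (t + k)) ∈ X) (hg : Generators X n g) :
    Set.InjOn (encode n g) {s | ∀ k, s k ∈ leading X (n + 1)} := by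
  intro s hs s' hs' heq
  replace hs : ∀ k, s k ∈ leading X (n + 1) := hs
  replace hs' : ∀ k, s' k ∈ leading X (n + 1) := hs'
  suffices h : ∀ k, (s k)⁻¹ * s' k ∈ leading X 0 by
    refine funext fun k => ?_
    have := h k
    rwa [leading, supportedIn_zero, Subgroup.map_bot, Subgroup.mem_bot, inv_mul_eq_one] at this
  refine Nat.decreasingInduction (n := n + 1)
    (motive := fun i _ => ∀ k, (s k)⁻¹ * s' k ∈ leading X i) ?_
    (fun k => Subgroup.mul_mem _ (Subgroup.inv_mem _ (hs k)) (hs' k)) (Nat.zero_le _)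
  intro i _ hi k
  set past : (ℤ → A) → ℤ → A := fun s l => if l < k then s l else 1 with hpast
  have hpm : ∀ s : ℤ → A, (∀ k, s k ∈ leading X (n + 1)) → ∀ l, past s l ∈ leading X (n + 1) := by
    intro s hs l
    simp only [hpast]
    split_ifs
    · exact hs l
    · exact Subgroup.one_mem _
  have hlt : ∀ (s : ℤ → A) (t : ℤ), t < k → encode n g (past s) t = encode n g s t := by
    intro s t ht
    refine encode_congr fun l hl => ?_
    simp only [hpast]
    rw [if_pos (by omega)]
  have hat : ∀ s : ℤ → A, (∀ k, s k ∈ leading X (n + 1)) →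
      encode n g s k = encode n g (past s) k * s k := by
    intro s hs
    unfold encode
    rw [windowProd_succ_last, windowProd_succ_last, sub_add_cancel, sub_self,
      hg.apply_zero _ (hs k), hg.apply_zero _ (hpm s hs k)]
    simp only [hpast, lt_irrefl, if_false, mul_one]
    congr 1
    refine windowProd_congr fun l _ hl => ?_
    rw [if_pos (by omega)]
  -- Past factors start at `l ≤ k - 1`, so `t - l ≥ i + 1`, where generators differing at level `i +
  -- 1` already agree.
  have hge : ∀ t, k + i ≤ t → encode n g (past s) t = encode n g (past s') t := by
    intro t ht
    refine encode_congr fun l _ => ?_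
    simp only [hpast]
    split_ifs with hlk
    · have := (hg.inv_mul_mem (i + 1) _ (hs l) _ (hs' l) (hi l)).2 (t - l) (by push_cast; omega)
      rwa [Pi.mul_apply, Pi.inv_apply, inv_mul_eq_one] at this
    · rfl
  have hz := X.mul_mem (X.inv_mem (hg.encode_mem hX hinv (hpm s' hs')))
    (hg.encode_mem hX hinv (hpm s hs))
  have hsk := (hg.mem_supportedIn_of_mem (hs k)).1
  -- The quotient of the past encodings is supported in `[k, k + i)` and has value `s' k * (s k)⁻¹`
  -- at `k`. Conjugating by `g (s k)` turns this value into `(s k)⁻¹ * s' k`.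
  have hw : (g (s k))⁻¹ *
      (fun t => ((encode n g (past s'))⁻¹ * encode n g (past s)) (t + k)) * g (s k) ∈
        supportedIn X i := by
    refine ⟨X.mul_mem (X.mul_mem (X.inv_mem hsk) (hinv _ hz k)) hsk, fun t ht => ?_⟩
    have h1 : encode n g (past s') (t + k) = encode n g (past s) (t + k) := by
      rcases ht with ht | ht
      · rw [hlt s' _ (by omega), hlt s _ (by omega), heq]
      · exact (hge _ (by omega)).symm
    simp [h1]
  have hw0 := mem_leading_of_mem hw
  have h1 := hat s hs
  have h2 := hat s' hs'
  rw [← heq, h1] at h2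
  simp only [Pi.mul_apply, Pi.inv_apply, zero_add, hg.apply_zero _ (hs k)] at hw0
  have h3 : encode n g (past s) k = encode n g (past s') k * s' k * (s k)⁻¹ :=
    eq_mul_inv_of_mul_eq h2
  rw [h3] at hw0
  simpa [mul_assoc] using hw0

end Generators

/-- A closed shift-invariant group of sequences over a finite group in which the finitely supported
sequences are dense is conjugate to a full shift. -/
theorem exists_homeomorph_fullShift [TopologicalSpace A] [DiscreteTopology A] [Finite A]
    {X : Subgroup (ℤ → A)} (hX : IsClosed (X : Set (ℤ → A)))
    (hinv : ∀ x ∈ X, ∀ k : ℤ, (fun t => x (t + k)) ∈ X)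
    (hd : (X : Set (ℤ → A)) ⊆ closure {x | x ∈ X ∧ ∃ N : ℕ, ∀ t : ℤ, (N : ℤ) ≤ |t| → x t = 1}) :
    ∃ k : ℕ, 0 < k ∧ ∃ e : (ℤ → Fin k) ≃ₜ X,
      ∀ (s : ℤ → Fin k) (t : ℤ), (e fun i => s (i + 1)).1 t = (e s).1 (t + 1) := by
  obtain ⟨n, g, hg⟩ := exists_generators X
  obtain ⟨k, ⟨f⟩⟩ := Finite.exists_equiv_fin (leading X (n + 1))
  let dec : (ℤ → Fin k) → ℤ → A := fun s i => (f.symm (s i) : A)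
  have hdec : ∀ s i, dec s i ∈ leading X (n + 1) := fun s i => (f.symm (s i)).2
  have hdecc : Continuous dec := continuous_pi fun i =>
    (continuous_of_discreteTopology (f := fun a => (f.symm a : A))).comp (continuous_apply i)
  let E : (ℤ → Fin k) → X := fun s => ⟨encode n g (dec s), hg.encode_mem hX hinv (hdec s)⟩
  have hE : Continuous E := ((continuous_encode n g).comp hdecc).subtype_mk _
  have hbij : Function.Bijective E := by
    constructor
    · intro s s' h
      have h1 := hg.injOn_encode hX hinv (hdec s) (hdec s') (congrArg Subtype.val h)
      exact funext fun i => f.symm.injective (Subtype.ext (congrFun h1 i))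
    · rintro ⟨x, hx⟩
      obtain ⟨s, hs, rfl⟩ := hg.surjOn_encode hinv hd hx
      refine ⟨fun i => f ⟨s i, hs i⟩, Subtype.ext ?_⟩
      simp [E, dec]
  refine ⟨k, Fin.pos (f 1), hE.homeoOfEquivCompactToT2 (f := Equiv.ofBijective E hbij),
    fun s t => ?_⟩
  exact encode_shift n g (dec s) t

end Encoder

/-! ### Symbolic coding of `Gt` -/

section Conjugacy

variable {G : Type*} [Group G] [TopologicalSpace G] [IsTopologicalGroup G]

theorem coe_iter_Tt (T : G ≃ₜ* G) (H : Subgroup G) (n : ℤ) (g : Gt T H) :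
    (iter (Tt T H) n g : G) = iter T n g := by
  induction n generalizing g with
  | zero => simp
  | succ n ih =>
    rw [← iter_apply_apply, ih, ← iter_apply_apply]
    rfl
  | pred n ih =>
    obtain ⟨h, rfl⟩ : ∃ h, g = Tt T H h := ⟨(Tt T H).symm g, by simp⟩
    rw [iter_apply_apply, sub_add_cancel, ih]
    change _ = iter T _ (T h)
    rw [iter_apply_apply, sub_add_cancel]

/-- In a compact group an open subgroup has finite index, so its normal core is closed of finite
index, hence open. -/
theorem exists_normal_le_of_compactSpace {K : Type*} [Group K] [TopologicalSpace K]
    [IsTopologicalGroup K] [CompactSpace K] {H : Subgroup K} (ho : IsOpen (H : Set K)) :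
    ∃ N : Subgroup K, N.Normal ∧ N ≤ H ∧ IsOpen (N : Set K) := by
  have := H.quotient_finite_of_isOpen ho
  have : H.FiniteIndex := Subgroup.finiteIndex_of_finite_quotient
  exact ⟨H.normalCore, inferInstance, H.normalCore_le,
    Subgroup.isOpen_of_isClosed_of_finiteIndex _
      (H.normalCore_isClosed (H.isClosed_of_isOpen ho))⟩

/-- The itinerary of a point with respect to the cosets of a normal subgroup. -/
def itinerary {K : Type*} [Group K] [TopologicalSpace K] (S : K ≃ₜ* K) (N : Subgroup K)
    [N.Normal] : K →* (ℤ → K ⧸ N) where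
  toFun g n := QuotientGroup.mk (iter S n g)
  map_one' := by
    ext n
    simp
  map_mul' a b := by
    ext n
    simp

theorem itinerary_apply {K : Type*} [Group K] [TopologicalSpace K] (S : K ≃ₜ* K) (N : Subgroup K)
    [N.Normal] (g : K) (n : ℤ) : itinerary S N g n = QuotientGroup.mk (iter S n g) := rfl

/-- An automorphism of a compact group with a separating open subgroup and a dense set of
homoclinic points is conjugate to a full shift. -/
theorem topConjugate_fullShift {K : Type*} [Group K] [TopologicalSpace K]
    [IsTopologicalGroup K] [CompactSpace K] (S : K ≃ₜ* K) {H : Subgroup K}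
    (ho : IsOpen (H : Set K)) (hsep : stay S H Set.univ = ⊥)
    (hd : Dense {g : K | ∀ U ∈ nhds (1 : K), ∃ N : ℕ, ∀ n : ℤ, (N : ℤ) ≤ |n| → iter S n g ∈ U}) :
    ∃ k : ℕ, 0 < k ∧ TopConjugate S
      (SymbolicDynamics.FullShift.shift (1 : ℤ) : (ℤ → Fin k) → (ℤ → Fin k)) := by
  obtain ⟨N, hNn, hNH, hNo⟩ := exists_normal_le_of_compactSpace ho
  have := N.quotient_finite_of_isOpen hNo
  have := QuotientGroup.discreteTopology hNo
  have hcont : Continuous (itinerary S N) := continuous_pi fun n =>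
    QuotientGroup.continuous_mk.comp (continuous_iter S n)
  have hinj : Function.Injective (itinerary S N) := by
    rw [injective_iff_map_eq_one]
    intro g hg
    have h : g ∈ stay S H Set.univ := fun n _ =>
      hNH ((QuotientGroup.eq_one_iff _).1 (congrFun hg n))
    rwa [hsep, Subgroup.mem_bot] at h
  have hemb := hcont.isClosedEmbedding hinj
  have hinv : ∀ x ∈ (itinerary S N).range, ∀ k : ℤ,
      (fun t => x (t + k)) ∈ (itinerary S N).range := by
    rintro _ ⟨g, rfl⟩ k
    refine ⟨iter S k g, funext fun t => ?_⟩
    rw [itinerary_apply, itinerary_apply, iter_add_apply]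
  obtain ⟨k, hk, e, he⟩ := exists_homeomorph_fullShift (X := (itinerary S N).range)
    -- Homoclinic points have finitely supported itineraries, so density passes to the image.
    (by simpa using hemb.isClosed_range) hinv (by
      rintro _ ⟨g, rfl⟩
      refine map_mem_closure hcont (hd g) fun x hx => ⟨⟨x, rfl⟩, ?_⟩
      obtain ⟨M, hM⟩ := hx N (hNo.mem_nhds N.one_mem)
      exact ⟨M, fun t ht => (QuotientGroup.eq_one_iff _).2 (hM t ht)⟩)
  let φ : K ≃ₜ (itinerary S N).range := hemb.isEmbedding.toHomeomorph
  have hφ : ∀ g t, (φ g).1 t = itinerary S N g t := fun g t => rfl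
  refine ⟨k, hk, φ.trans e.symm, fun g => ?_⟩
  change e.symm (φ (S g)) = _
  rw [Homeomorph.symm_apply_eq]
  refine Subtype.ext (funext fun t => ?_)
  have h : SymbolicDynamics.FullShift.shift (1 : ℤ) ((φ.trans e.symm) g) =
      fun i => (φ.trans e.symm) g (i + 1) := by
    funext i
    rw [SymbolicDynamics.FullShift.shift_apply, add_comm]
  rw [h, he, Homeomorph.trans_apply, Homeomorph.apply_symm_apply, hφ, hφ, itinerary_apply,
    itinerary_apply, iter_apply_apply]

theorem topConjugate_Tt [T2Space G] (T : G ≃ₜ* G) {H : Subgroup G}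
    (hc : IsCompact (H : Set G)) (ho : IsOpen (H : Set G)) (hs : SeparatesPoints T (H : Set G)) :
    ∃ k : ℕ, 0 < k ∧ TopConjugate (Tt T H)
      (SymbolicDynamics.FullShift.shift (1 : ℤ) : (ℤ → Fin k) → (ℤ → Fin k)) := by
  have : CompactSpace (Gt T H) := isCompact_iff_compactSpace.1 (isCompact_Gt T hc ho)
  refine topConjugate_fullShift (Tt T H) (H := H.subgroupOf (Gt T H))
    (ho.preimage continuous_subtype_val) ?_ ?_
  · refine (Subgroup.eq_bot_iff_forall _).2 fun g hg => Subtype.ext ?_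
    have h : (g : G) ∈ stay T H Set.univ := fun n hn => by
      rw [← coe_iter_Tt]
      exact hg n hn
    rwa [stay_univ T hs, Subgroup.mem_bot] at h
  · intro g
    rw [closure_subtype]
    refine closure_mono (fun x hx => ?_) g.2
    refine ⟨⟨x, subset_closure hx⟩, fun U hU => ?_, rfl⟩
    obtain ⟨W, hW, hWU⟩ := mem_nhds_subtype _ _ _ |>.1 hU
    obtain ⟨N, hN⟩ := exists_iter_mem_of_mem_nhds hc hs hW hx
    refine ⟨N, fun n hn => hWU ?_⟩
    change (iter (Tt T H) n _ : G) ∈ W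
    rw [coe_iter_Tt]
    exact hN n hn

end Conjugacy

end ExpansiveAut

theorem mainTheorem3 {G : Type*} [Group G] [TopologicalSpace G] [IsTopologicalGroup G]
    [SecondCountableTopology G] [T2Space G] [LocallyCompactSpace G] [TotallyDisconnectedSpace G]
    (T : G ≃ₜ* G) (hT : ExpansiveAut.IsExpansive T)
    (H : Subgroup G) (hHc : IsCompact (H : Set G)) (hHo : IsOpen (H : Set G))
    (hHs : ExpansiveAut.SeparatesPoints T (H : Set G)) :
    IsCompact (ExpansiveAut.Gt T H : Set G) ∧
    (∃ k : ℕ, 0 < k ∧ ExpansiveAut.TopConjugate (ExpansiveAut.Tt T H)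
      (SymbolicDynamics.FullShift.shift (1 : ℤ) : (ℤ → Fin k) → (ℤ → Fin k))) ∧
    ExpansiveAut.Gt T H ≤ ExpansiveAut.Gc T ∧
    IsOpen (((ExpansiveAut.Gt T H).subgroupOf (ExpansiveAut.Gc T) :
      Subgroup (ExpansiveAut.Gc T)) : Set (ExpansiveAut.Gc T)) ∧
    Countable (ExpansiveAut.Gc T ⧸ (ExpansiveAut.Gt T H).subgroupOf (ExpansiveAut.Gc T)) ∧
    DiscreteTopology
      (ExpansiveAut.Gc T ⧸ (ExpansiveAut.Gt T H).subgroupOf (ExpansiveAut.Gc T)) := by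
  have ho := ExpansiveAut.isOpen_Gt_subgroupOf_Gc T hHc hHo hHs
  have hd := QuotientGroup.discreteTopology ho
  have hsc : SecondCountableTopology (ExpansiveAut.Gc T) :=
    TopologicalSpace.Subtype.secondCountableTopology (ExpansiveAut.Gc T : Set G)
  have hsep : TopologicalSpace.SeparableSpace
      (ExpansiveAut.Gc T ⧸ (ExpansiveAut.Gt T H).subgroupOf (ExpansiveAut.Gc T)) :=
    QuotientGroup.mk_surjective.denseRange.separableSpace QuotientGroup.continuous_mk
  exact ⟨ExpansiveAut.isCompact_Gt T hHc hHo, ExpansiveAut.topConjugate_Tt T hHc hHo hHs,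
    ExpansiveAut.Gt_le_Gc T hHc hHo, ho, TopologicalSpace.separableSpace_iff_countable.1 hsep, hd⟩
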